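/- Let $p$ be an odd prime, $n \ge 1$, and let $G = \mathrm{Hol}(C_{p^n}) = C_{p^n} \rtimes \mathrm{Aut}(C_{p^n})$ be the holomorph of the cyclic group of order $p^n$ (the semidirect product for the natural action). Then every irreducible complex representation $\widetilde\rho$ of $G$ has Schur index $1$ over $\mathbb{Q}$. Here the Schur index of $\widetilde\rho$ over $\mathbb{Q}$ is the multiplicity of $\widetilde\rho$ in $\rho \otimes_{\mathbb{Q}} \mathbb{C}$, where $\rho$ is the irreducible representation of $G$ over $\mathbb{Q}$, unique up to equivalence, such that $\widetilde\rho$ is a constituent of $\rho \otimes_{\mathbb{Q}} \mathbb{C}$. -/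

import Mathlib

open scoped TensorProduct

universe u

/-- The holomorph of a group `N`: the semidirect product of `N` with its automorphism group, with
respect to the natural action of `MulAut N` on `N`. -/
abbrev Holomorph (N : Type*) [Group N] : Type _ :=
  N ⋊[MonoidHom.id (MulAut N)] MulAut N

/-- Extension of scalars `ρ ⊗ K` of a representation `ρ` along a field extension `K / F`: the
element `g` acts on `K ⊗ W` by `id ⊗ ρ g`. -/
noncomputable def Representation.extendScalars {F : Type*} [Field F] (K : Type*) [Field K]
    [Algebra F K] {G W : Type*} [Group G] [AddCommGroup W] [Module F W]
    (ρ : Representation F G W) : Representation K G (K ⊗[F] W) where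
  toFun g := (ρ g).baseChange K
  map_one' := by
    rw [map_one]
    exact LinearMap.baseChange_id
  map_mul' g h := by
    rw [map_mul]
    exact LinearMap.baseChange_comp _ _

/-- The multiplicity of an irreducible representation `σ` as a constituent of the
finite-dimensional representation `τ`, over an algebraically closed field: the dimension of the
space of `G`-equivariant linear maps from `σ` to `τ`. -/
noncomputable def Representation.multiplicity {K G V W : Type*} [Field K] [Group G]
    [AddCommGroup V] [Module K V] [AddCommGroup W] [Module K W]
    (σ : Representation K G V) (τ : Representation K G W) : ℕ :=
  Module.finrank K (Representation.IntertwiningMap σ τ)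

/-- `IsSchurIndex F σ m`: the Schur index with respect to `F` of the irreducible representation `σ`
(of the finite group `G` over an algebraically closed extension `K` of `F`) is `m`.
That is, there is, up to equivalence, a unique irreducible representation `ρ` of `G` over `F` such
that `σ` is a constituent of `ρ ⊗ K`, and the multiplicity of `σ` in `ρ ⊗ K` is `m`. -/
def Representation.IsSchurIndex (F : Type u) [Field F] {K V : Type*} {G : Type u} [Field K]
    [Algebra F K] [Group G] [AddCommGroup V] [Module K V]
    (σ : Representation K G V) (m : ℕ) : Prop :=
  ∃ (W : Type u) (_ : AddCommGroup W) (_ : Module F W) (ρ : Representation F G W),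
    ρ.IsIrreducible ∧ σ.multiplicity (ρ.extendScalars K) ≠ 0 ∧
    (∀ (W' : Type u) (_ : AddCommGroup W') (_ : Module F W') (ρ' : Representation F G W'),
      ρ'.IsIrreducible → σ.multiplicity (ρ'.extendScalars K) ≠ 0 →
        Nonempty (Representation.Equiv ρ' ρ)) ∧
    σ.multiplicity (ρ.extendScalars K) = m

open scoped MonoidAlgebra

/-! A rational representation whose complexification contains σ exactly once forces Schur index 1
(`isSchurIndex_one_of_multiplicity_eq_one`). By Frobenius reciprocity, the permutation
representation on G/⟨h⟩ is of this kind once the h-fixed functionals on σ form a line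
(`isSchurIndex_one_of_invariant_functional`). It remains to find such an h.

Let A and D be the actions of translations and units. Take v with A(1)v = μv, μ of order p^k. The
units r with μ^r = μ are those ≡ 1 mod p^k; they are generated by w = g^φ(p^k), where g generates
all units, and v can be chosen with D(w)v = lv, l of order p^j. By irreducibility the D(r)v span V.
For h = A(c)D(s) with s^m = w^b, h^m scales D(r)v by ζ^(r⁻¹)·l^b, with ζ a power of μ controlled by
c. If ζ·l^b = 1, a fixed functional can be nonzero on D(r)v only for r ≡ 1 mod ord ζ; if such r are
products of powers of s and w, its value there is determined by its value at v
(`exists_fixed_and_functional_unique`). The choice of c and s depends on whether k = 0, j > k or j ≤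
k (`exists_fixed_and_functional_unique_of_prime_pow`). -/

theorem TensorProduct.equivFinsuppOfBasisLeft_baseChange {F K ι W W' : Type*} [DecidableEq ι] [Field F]
    [Field K]
    [Algebra F K] [AddCommGroup W] [Module F W] [AddCommGroup W'] [Module F W']
    (b : Module.Basis ι F K) (f : W →ₗ[F] W') (x : K ⊗[F] W) (i : ι) :
    TensorProduct.equivFinsuppOfBasisLeft b (f.baseChange K x) i =
      f (TensorProduct.equivFinsuppOfBasisLeft b x i) := by
  induction x with
  | zero => simp
  | tmul a w => simp
  | add x y hx hy => simp [hx, hy]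

namespace Representation

/-! ### Descent of intertwining maps along a field extension. -/

section ExtendScalars

variable {F K G V W W' : Type*} [Field F] [Field K] [Algebra F K] [Group G] [AddCommGroup V]
  [Module K V] [AddCommGroup W] [Module F W] [AddCommGroup W'] [Module F W']

@[simp]
theorem extendScalars_apply (ρ : Representation F G W) (g : G) :
    ρ.extendScalars K g = (ρ g).baseChange K := rfl

/-- Extension of scalars of an intertwining map. -/
noncomputable def IntertwiningMap.extendScalars (K : Type*) [Field K] [Algebra F K]
    {ρ : Representation F G W} {τ : Representation F G W'} (f : IntertwiningMap ρ τ) :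
    IntertwiningMap (ρ.extendScalars K) (τ.extendScalars K) where
  toLinearMap := f.toLinearMap.baseChange K
  isIntertwining' g := by
    rw [extendScalars_apply, extendScalars_apply, ← LinearMap.baseChange_comp, f.isIntertwining',
      LinearMap.baseChange_comp]

theorem IntertwiningMap.extendScalars_apply {ρ : Representation F G W}
    {τ : Representation F G W'} (f : IntertwiningMap ρ τ) (x : K ⊗[F] W) :
    f.extendScalars K x = f.toLinearMap.baseChange K x := rfl

theorem IntertwiningMap.extendScalars_injective {ρ : Representation F G W}
    {τ : Representation F G W'} {f : IntertwiningMap ρ τ} (hf : Function.Injective f) :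
    Function.Injective (f.extendScalars K) := by
  classical
  intro x y hxy
  let b := Module.Basis.ofVectorSpace F K
  apply (TensorProduct.equivFinsuppOfBasisLeft b).injective
  ext i
  apply hf
  have := congrArg (fun z => TensorProduct.equivFinsuppOfBasisLeft b z i) hxy
  simpa only [IntertwiningMap.extendScalars_apply,
    TensorProduct.equivFinsuppOfBasisLeft_baseChange] using! this

/-- A nonzero intertwining map between extensions of scalars yields a nonzero intertwining map over
the base field. -/
theorem IntertwiningMap.exists_ne_zero_of_extendScalars {ρ : Representation F G W}
    {τ : Representation F G W'}
    (f : IntertwiningMap (ρ.extendScalars K) (τ.extendScalars K)) (hf : f ≠ 0) :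
    ∃ f₀ : IntertwiningMap ρ τ, f₀ ≠ 0 := by
  classical
  let b := Module.Basis.ofVectorSpace F K
  let c := TensorProduct.equivFinsuppOfBasisLeft (N := W') b
  obtain ⟨w, hw⟩ : ∃ w : W, f (1 ⊗ₜ w) ≠ 0 := by
    by_contra! h
    apply hf
    ext w
    simpa using! h w
  obtain ⟨i, hi⟩ : ∃ i, c (f (1 ⊗ₜ w)) i ≠ 0 := by
    by_contra! h
    exact hw (c.injective (by ext i; simp [h]))
  let l : W →ₗ[F] W' := (Finsupp.lapply i).comp
    (c.toLinearMap.comp ((f.toLinearMap.restrictScalars F).comp (TensorProduct.mk F K W 1)))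
  refine ⟨⟨l, fun g => ?_⟩, fun h => hi ?_⟩
  · ext v
    have h1 : f (1 ⊗ₜ ρ g v) = (τ g).baseChange K (f (1 ⊗ₜ v)) := by
      have := IntertwiningMap.isIntertwining _ _ f g (1 ⊗ₜ v)
      simpa using this
    change c (f (1 ⊗ₜ ρ g v)) i = τ g (c (f (1 ⊗ₜ v)) i)
    rw [h1]
    exact TensorProduct.equivFinsuppOfBasisLeft_baseChange b (τ g) _ i
  · exact congrArg (fun z : IntertwiningMap ρ τ => z w) h

end ExtendScalars

/-- Postcomposition with an intertwining map, as a linear map. -/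
def IntertwiningMap.postcomp {K G V W W' : Type*} [Field K] [Group G] [AddCommGroup V]
    [Module K V] [AddCommGroup W] [Module K W] [AddCommGroup W'] [Module K W']
    (σ : Representation K G V) {ρ : Representation K G W} {τ : Representation K G W'}
    (f : IntertwiningMap ρ τ) : IntertwiningMap σ ρ →ₗ[K] IntertwiningMap σ τ where
  toFun h := f.comp h
  map_add' _ _ := by ext v; simp
  map_smul' _ _ := by ext v; simp

/-! ### Complete reducibility and the multiplicity-one criterion. -/

section Maschke

variable {K G V W W' : Type*} [Field K] [Group G] [Finite G] [CharZero K] [AddCommGroup V]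
  [Module K V] [AddCommGroup W] [Module K W] [AddCommGroup W'] [Module K W']

theorem IntertwiningMap.exists_comp_eq_id {ρ : Representation K G W} {τ : Representation K G W'}
    (f : IntertwiningMap ρ τ) (hf : Function.Injective f) :
    ∃ g : IntertwiningMap τ ρ, ∀ w, g (f w) = w := by
  have : NeZero (Nat.card G : K) := ⟨Nat.cast_ne_zero.mpr Nat.card_pos.ne'⟩
  obtain ⟨g, hg⟩ := MonoidAlgebra.exists_leftInverse_of_injective
    (IntertwiningMap.equivLinearMapAsModule ρ τ f) (LinearMap.ker_eq_bot.mpr hf)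
  exact ⟨(IntertwiningMap.equivLinearMapAsModule τ ρ).symm g, fun w => LinearMap.congr_fun hg w⟩

/-- A representation of a finite group in characteristic zero has a family of irreducible
subrepresentations with equivariant projections onto them that jointly separate vectors. -/
theorem exists_irreducible_projections (G : Type u) [Group G] [Finite G] {M : Type u}
    [AddCommGroup M] [Module K M] (τ : Representation K G M) :
    ∃ (ι : Type u) (S : ι → Type u) (_ : ∀ i, AddCommGroup (S i)) (_ : ∀ i, Module K (S i))
      (ρ : ∀ i, Representation K G (S i)) (inc : ∀ i, IntertwiningMap (ρ i) τ)
      (proj : ∀ i, IntertwiningMap τ (ρ i)), (∀ i, (ρ i).IsIrreducible) ∧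
      (∀ i, Function.Injective (inc i)) ∧ ∀ x, (∀ i, proj i x = 0) → x = 0 := by
  have : NeZero (Nat.card G : K) := ⟨Nat.cast_ne_zero.mpr Nat.card_pos.ne'⟩
  obtain ⟨s, e, -, hs⟩ := IsSemisimpleModule.exists_linearEquiv_dfinsupp K[G] τ.asModule
  let r (m : s) : Subrepresentation τ := Subrepresentation.ofSubmodule' m.1
  let inc (m : s) : IntertwiningMap (r m).toRepresentation τ :=
    { toLinearMap := (r m).toSubmodule.subtype
      isIntertwining' := fun _ => rfl }
  have hinj (m : s) : Function.Injective (IntertwiningMap.equivLinearMapAsModule _ _ (inc m)) :=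
    Subtype.val_injective
  have hrange (m : s) :
      LinearMap.range (IntertwiningMap.equivLinearMapAsModule _ _ (inc m)) = m.1 := by
    ext x
    exact ⟨fun ⟨y, hy⟩ => hy ▸ y.2, fun hx => ⟨⟨x, hx⟩, rfl⟩⟩
  let c (m : s) : (r m).toRepresentation.asModule ≃ₗ[K[G]] m.1 :=
    (LinearEquiv.ofInjective _ (hinj m)).trans (LinearEquiv.ofEq _ _ (hrange m))
  refine ⟨s, fun m => (r m).toSubmodule, fun m => inferInstance, fun m => inferInstance,
    fun m => (r m).toRepresentation, inc,
    fun m => (IntertwiningMap.equivLinearMapAsModule _ _).symm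
      ((c m).symm.toLinearMap.comp ((DFinsupp.lapply m).comp e.toLinearMap)), ?_, hinj, ?_⟩
  · intro m
    have := hs m
    exact (irreducible_iff_isSimpleModule_asModule _).mpr (IsSimpleModule.congr (c m))
  · intro x hx
    exact (e.map_eq_zero_iff (x := x)).mp
      (DFinsupp.ext fun m => (c m).symm.map_eq_zero_iff.mp (hx m))

end Maschke

section Multiplicity

variable {K G V W W' : Type*} [Field K] [Group G] [AddCommGroup V] [Module K V]
  [AddCommGroup W] [Module K W] [AddCommGroup W'] [Module K W'] {σ : Representation K G V}
  {ρ : Representation K G W} {τ : Representation K G W'}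

theorem exists_ne_zero_of_multiplicity_ne_zero (h : σ.multiplicity ρ ≠ 0) :
    ∃ f : IntertwiningMap σ ρ, f ≠ 0 := by
  by_contra! h'
  have : Subsingleton (IntertwiningMap σ ρ) := ⟨fun a b => (h' a).trans (h' b).symm⟩
  exact h Module.finrank_zero_of_subsingleton

theorem multiplicity_eq_one {f : IntertwiningMap σ ρ} (hf : f ≠ 0)
    (h : ∀ g : IntertwiningMap σ ρ, ∃ c : K, c • f = g) : σ.multiplicity ρ = 1 :=
  finrank_eq_one f hf h

theorem multiplicity_eq_one_of_injective (i : IntertwiningMap ρ τ) (hi : Function.Injective i)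
    (hτ : σ.multiplicity τ = 1) {f : IntertwiningMap σ ρ} (hf : f ≠ 0) :
    σ.multiplicity ρ = 1 := by
  have hinj : Function.Injective (IntertwiningMap.postcomp σ i) := by
    intro a c hac
    ext v
    exact hi (congrArg (fun z : IntertwiningMap σ _ => z v) hac)
  have : Module.Finite K (IntertwiningMap σ τ) := Module.finite_of_finrank_eq_succ hτ
  have : Module.Finite K (IntertwiningMap σ ρ) := Module.Finite.of_injective _ hinj
  apply le_antisymm
  · exact (LinearMap.finrank_le_finrank_of_injective hinj).trans hτ.le
  · have : Nontrivial (IntertwiningMap σ ρ) := ⟨_, _, hf⟩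
    exact Module.finrank_pos (R := K) (M := IntertwiningMap σ ρ)

end Multiplicity

/-- A representation over `F` in which `σ` has multiplicity one forces the Schur index of `σ` over
`F` to be one. -/
theorem isSchurIndex_one_of_multiplicity_eq_one {K V : Type*} {F : Type u} [Field F] [CharZero F]
    [Field K] [Algebra F K] {G M : Type u} [Group G] [Finite G] [AddCommGroup V] [Module K V]
    [AddCommGroup M] [Module F M] {σ : Representation K G V} (hσ : σ.IsIrreducible)
    (τ : Representation F G M) (hτ : σ.multiplicity (τ.extendScalars K) = 1) :
    IsSchurIndex F σ 1 := by
  classical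
  have : CharZero K := charZero_of_injective_algebraMap (algebraMap F K).injective
  obtain ⟨f, hf⟩ := exists_ne_zero_of_multiplicity_ne_zero (hτ.trans_ne one_ne_zero)
  obtain ⟨ι, S, _, _, ρ, inc, proj, hirr, hinc, hproj⟩ := exists_irreducible_projections G τ
  let b := Module.Basis.ofVectorSpace F K
  obtain ⟨v, hv⟩ : ∃ v, f v ≠ 0 := by
    by_contra! h
    exact hf (by ext v; exact h v)
  obtain ⟨j, hj⟩ : ∃ j, TensorProduct.equivFinsuppOfBasisLeft b (f v) j ≠ 0 := by
    by_contra! h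
    exact hv ((TensorProduct.equivFinsuppOfBasisLeft b).injective (by ext i; simp [h]))
  -- Some irreducible constituent of τ receives a nonzero component of `f`; this is the rational
  -- representation sought.
  obtain ⟨i, hi⟩ : ∃ i, proj i (TensorProduct.equivFinsuppOfBasisLeft b (f v) j) ≠ 0 := by
    by_contra! h
    exact hj (hproj _ h)
  have hfi : ((proj i).extendScalars K).comp f ≠ 0 := by
    intro h
    apply hi
    have h1 : (proj i).toLinearMap.baseChange K (f v) = 0 :=
      congrArg (fun z : IntertwiningMap σ _ => z v) h
    have h2 := TensorProduct.equivFinsuppOfBasisLeft_baseChange b (proj i).toLinearMap (f v) j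
    rw [h1] at h2
    simpa using h2.symm
  have hone : σ.multiplicity ((ρ i).extendScalars K) = 1 :=
    multiplicity_eq_one_of_injective ((inc i).extendScalars K)
      (IntertwiningMap.extendScalars_injective (hinc i)) hτ hfi
  refine ⟨S i, inferInstance, inferInstance, ρ i, hirr i, hone.trans_ne one_ne_zero, ?_, hone⟩
  intro W' _ _ ρ' hρ' hmult
  obtain ⟨f', hf'⟩ := exists_ne_zero_of_multiplicity_ne_zero hmult
  -- Splitting off σ from ρ' ⊗ K gives a nonzero map ρ' ⊗ K → ρ ⊗ K through σ; it descends to F,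
  -- where Schur's lemma makes it an isomorphism.
  obtain ⟨g, hg⟩ := f'.exists_comp_eq_id
    ((IsIrreducible.injective_or_eq_zero f').resolve_right hf')
  set q := ((proj i).extendScalars K).comp f
  obtain ⟨φ, hφ⟩ := IntertwiningMap.exists_ne_zero_of_extendScalars (q.comp g) (by
    intro h
    apply hfi
    ext v
    have := congrArg (fun z : IntertwiningMap (ρ'.extendScalars K) _ => z (f' v)) h
    simpa [hg] using! this)
  have := hirr i
  exact ⟨φ.ofBijective ((IsIrreducible.bijective_or_eq_zero φ).resolve_right hφ)⟩

end Representation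

/-! ### Permutation representations and Frobenius reciprocity. -/

namespace Representation

/-- The representation of `G` on the functions on a `G`-set. -/
def functions (F G X : Type*) [Field F] [Group G] [MulAction G X] :
    Representation F G (X → F) where
  toFun g := LinearMap.funLeft F F (g⁻¹ • ·)
  map_one' := by ext; simp [LinearMap.funLeft]
  map_mul' g h := by ext; simp [LinearMap.funLeft, mul_smul]

theorem functions_apply {F G X : Type*} [Field F] [Group G] [MulAction G X] (g : G) (f : X → F)
    (x : X) : functions F G X g f x = f (g⁻¹ • x) := rfl

theorem piScalarRight_extendScalars_functions {F K G X : Type*} [Field F] [Field K] [Algebra F K]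
    [Group G] [MulAction G X] [Fintype X] [DecidableEq X] (g : G) (y : K ⊗[F] (X → F)) (x : X) :
    TensorProduct.piScalarRight F K K X ((functions F G X).extendScalars K g y) x =
      TensorProduct.piScalarRight F K K X y (g⁻¹ • x) := by
  induction y with
  | zero => simp
  | tmul a f => simp [functions_apply]
  | add y z hy hz => rw [map_add, map_add, Pi.add_apply, hy, hz, map_add, Pi.add_apply]

theorem apply_of_mem_zpowers {K G V : Type*} [Field K] [Group G] [Finite G] [AddCommGroup V]
    [Module K V] {σ : Representation K G V} {h : G} {l : V →ₗ[K] K} (hl : ∀ v, l (σ h v) = l v)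
    {k : G} (hk : k ∈ Subgroup.zpowers h) (v : V) : l (σ k v) = l v := by
  rw [← mem_powers_iff_mem_zpowers] at hk
  obtain ⟨n, rfl⟩ := hk
  induction n with
  | zero => simp
  | succ n ih =>
    simp only [pow_succ', map_mul, Module.End.mul_apply, hl] at ih ⊢
    exact ih

/-- If the functionals fixed by an element `h` are one-dimensional, then the Schur index is one:
the representation has multiplicity one in the permutation representation on the cosets of the
subgroup generated by `h`. -/
theorem isSchurIndex_one_of_invariant_functional {K V : Type*} {F : Type u} [Field F] [CharZero F]
    [Field K] [Algebra F K] {G : Type u} [Group G] [Finite G] [AddCommGroup V] [Module K V]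
    {σ : Representation K G V} (hσ : σ.IsIrreducible) (h : G) {l : V →ₗ[K] K} (hl0 : l ≠ 0)
    (hl : ∀ v, l (σ h v) = l v) (v₀ : V)
    (huniq : ∀ l' : V →ₗ[K] K, (∀ v, l' (σ h v) = l' v) → l' v₀ = 0 → l' = 0) :
    IsSchurIndex F σ 1 := by
  classical
  let H := Subgroup.zpowers h
  have : Fintype (G ⧸ H) := Fintype.ofFinite _
  let τ := functions F G (G ⧸ H)
  let e := TensorProduct.piScalarRight F K K (G ⧸ H)
  let x₀ : G ⧸ H := ((1 : G) : G ⧸ H)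
  have he (g : G) (y) (x) : e (τ.extendScalars K g y) x = e y (g⁻¹ • x) :=
    piScalarRight_extendScalars_functions g y x
  -- Frobenius reciprocity: evaluation at the trivial coset turns intertwining maps into h-fixed
  -- functionals, injectively by transitivity on cosets.
  let ev (f : IntertwiningMap σ (τ.extendScalars K)) : V →ₗ[K] K :=
    (LinearMap.proj x₀).comp (e.toLinearMap.comp f.toLinearMap)
  have hev (f) (v) : ev f v = e (f v) x₀ := rfl
  have hev_inv (f) (v) : ev f (σ h v) = ev f v := by
    rw [hev, hev, IntertwiningMap.isIntertwining _ _ f, he]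
    refine congrArg _ ?_
    change ((h⁻¹ * 1 : G) : G ⧸ H) = ((1 : G) : G ⧸ H)
    rw [QuotientGroup.eq]
    simp [H]
  have hev_zero (f) (hf : ev f v₀ = 0) : f = 0 := by
    have hf' := huniq (ev f) (hev_inv f) hf
    ext v
    apply e.injective
    ext x
    obtain ⟨g, rfl⟩ := QuotientGroup.mk_surjective x
    have h1 : e (f (σ g⁻¹ v)) x₀ = 0 := LinearMap.congr_fun hf' _
    rw [IntertwiningMap.isIntertwining _ _ f, he, inv_inv] at h1
    have h2 : g • x₀ = (g : G ⧸ H) := by simp [x₀]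
    rw [h2] at h1
    simpa using! h1
  let L (v : V) (x : G ⧸ H) : K := Quotient.liftOn' x (fun g => l (σ g⁻¹ v)) (by
    intro a b hab
    have hab' := QuotientGroup.leftRel_apply.mp hab
    have := apply_of_mem_zpowers hl (inv_mem hab') (σ a⁻¹ v)
    rw [← Module.End.mul_apply, ← map_mul] at this
    simpa using this.symm)
  have hL (v : V) (g : G) : L v (g : G ⧸ H) = l (σ g⁻¹ v) := rfl
  let L' : V →ₗ[K] (G ⧸ H → K) :=
    { toFun := L
      map_add' := fun v w => by
        ext x
        obtain ⟨g, rfl⟩ := QuotientGroup.mk_surjective x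
        simp [hL]
      map_smul' := fun c v => by
        ext x
        obtain ⟨g, rfl⟩ := QuotientGroup.mk_surjective x
        simp [hL] }
  let f : IntertwiningMap σ (τ.extendScalars K) :=
    { toLinearMap := e.symm.toLinearMap.comp L'
      isIntertwining' := fun g => by
        ext v
        apply e.injective
        ext x
        obtain ⟨k, rfl⟩ := QuotientGroup.mk_surjective x
        change e (e.symm (L (σ g v))) _ = e (τ.extendScalars K g (e.symm (L v))) _
        rw [he, e.apply_symm_apply, e.apply_symm_apply, hL, MulAction.Quotient.smul_coe, hL,
          ← Module.End.mul_apply, ← map_mul]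
        simp }
  have hevf : ev f = l := by
    ext v
    change e (e.symm (L v)) x₀ = l v
    rw [e.apply_symm_apply, hL]
    simp
  have hf : f ≠ 0 := by
    intro hf
    apply hl0
    rw [← hevf, hf]
    ext v
    simp [hev]
  have hfv : ev f v₀ ≠ 0 := fun h' => hf (hev_zero f h')
  refine isSchurIndex_one_of_multiplicity_eq_one hσ τ (multiplicity_eq_one hf fun g =>
    ⟨ev g v₀ / ev f v₀, sub_eq_zero.mp (hev_zero _ ?_)⟩)
  change e ((ev g v₀ / ev f v₀) • f v₀ - g v₀) x₀ = 0
  rw [map_sub, map_smul, Pi.sub_apply, Pi.smul_apply, ← hev, ← hev, smul_eq_mul,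
    div_mul_cancel₀ _ hfv, sub_self]

end Representation

theorem pow_eq_pow_iff_modEq₀ {K : Type*} [Field K] {x : K} (hx : x ≠ 0) {m n : ℕ} :
    x ^ m = x ^ n ↔ m ≡ n [MOD orderOf x] := by
  have h := pow_eq_pow_iff_modEq (x := Units.mk0 x hx) (m := n) (n := m)
  rwa [← orderOf_units, Units.ext_iff, Units.val_pow_eq_pow_val, Units.val_pow_eq_pow_val,
    Units.val_mk0] at h

/-! ### Operators satisfying the relations of the holomorph. -/

section Monomial

variable {K V : Type*} [Field K] [AddCommGroup V] [Module K V] {q : ℕ}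
  {A : Multiplicative (ZMod q) →* Module.End K V} {D : (ZMod q)ˣ →* Module.End K V}

theorem natCast_apply_eigenvector {v : V} {μ : K} (hv : A (.ofAdd 1) v = μ • v) (i : ℕ) :
    A (.ofAdd (i : ZMod q)) v = μ ^ i • v := by
  induction i with
  | zero => simp
  | succ i ih =>
    rw [Nat.cast_succ, ofAdd_add, map_mul, Module.End.mul_apply, hv, map_smul, ih, smul_smul,
      pow_succ']

theorem eigenvalue_pow_eq_one {v : V} (hv0 : v ≠ 0) {μ : K} (hv : A (.ofAdd 1) v = μ • v) :
    μ ^ q = 1 := by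
  have h1 := natCast_apply_eigenvector hv q
  rw [ZMod.natCast_self, ofAdd_zero, map_one, Module.End.one_apply] at h1
  have h2 : (μ ^ q - 1) • v = 0 := by rw [sub_smul, ← h1, one_smul, sub_self]
  exact sub_eq_zero.mp ((smul_eq_zero.mp h2).resolve_right hv0)

theorem apply_eigenvector [NeZero q] {v : V} {μ : K} (hv : A (.ofAdd 1) v = μ • v) (x : ZMod q) :
    A (.ofAdd x) v = μ ^ x.val • v := by
  rw [← natCast_apply_eigenvector hv, ZMod.natCast_zmod_val]

theorem apply_unit_apply_eigenvector [NeZero q]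
    (hAD : ∀ (s : (ZMod q)ˣ) (x : ZMod q), D s * A (.ofAdd x) = A (.ofAdd (s * x)) * D s)
    {v : V} {μ : K} (hv : A (.ofAdd 1) v = μ • v)
    (s : (ZMod q)ˣ) (x : ZMod q) :
    A (.ofAdd x) (D s v) = μ ^ (((s⁻¹ : (ZMod q)ˣ) : ZMod q) * x).val • D s v := by
  have := LinearMap.congr_fun (hAD s ((s⁻¹ : (ZMod q)ˣ) * x)) v
  rw [Module.End.mul_apply, Module.End.mul_apply, apply_eigenvector hv, map_smul,
    Units.mul_inv_cancel_left] at this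
  exact this.symm

theorem translation_mul_unit_pow
    (hAD : ∀ (s : (ZMod q)ˣ) (x : ZMod q), D s * A (.ofAdd x) = A (.ofAdd (s * x)) * D s)
    (c : ZMod q) (s : (ZMod q)ˣ) (t : ℕ) :
    (A (.ofAdd c) * D s) ^ t =
      A (.ofAdd (c * ∑ i ∈ Finset.range t, (s : ZMod q) ^ i)) * D (s ^ t) := by
  induction t with
  | zero => simp
  | succ t ih =>
    rw [pow_succ', ih, mul_assoc, ← mul_assoc (D s), hAD, mul_assoc, ← map_mul D, ← mul_assoc,
      ← map_mul A, ← ofAdd_add, ← pow_succ', Finset.sum_range_succ', pow_zero]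
    congr 4
    rw [mul_add, mul_one, add_comm, mul_left_comm, Finset.mul_sum]
    simp only [pow_succ']

/-- A criterion for the operator `A c * D s` to have a nonzero fixed vector and at most a line of
fixed functionals, in terms of a common eigenvector `v` of the translations and of `D w`. -/
theorem exists_fixed_and_functional_unique [NeZero q] [Fact (1 < q)]
    (hAD : ∀ (s : (ZMod q)ˣ) (x : ZMod q), D s * A (.ofAdd x) = A (.ofAdd (s * x)) * D s)
    (hirr : ∀ U : Submodule K V, U ≠ ⊥ → (∀ x, ∀ y ∈ U, A x y ∈ U) → (∀ s, ∀ y ∈ U, D s y ∈ U) →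
      U = ⊤)
    {v : V} (hv0 : v ≠ 0) {μ l : K} (hv : A (.ofAdd 1) v = μ • v) {w : (ZMod q)ˣ}
    (hw : D w v = l • v) (hμ : μ ≠ 0) {c : ZMod q} {s : (ZMod q)ˣ} {m b : ℕ} (hm : 0 < m)
    (hsm : s ^ m = w ^ b) {ζ : K}
    (hζ : ζ = μ ^ (c * ∑ i ∈ Finset.range m, (s : ZMod q) ^ i).val) (hζl : ζ * l ^ b = 1)
    (hgen : ∀ r : (ZMod q)ˣ, (r : ZMod q).val ≡ 1 [MOD orderOf ζ] → ∃ i j : ℕ, r = s ^ i * w ^ j)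
    (hinj : ∀ i < m, ∀ j < m, ((s⁻¹ ^ i : (ZMod q)ˣ) : ZMod q).val ≡
      ((s⁻¹ ^ j : (ZMod q)ˣ) : ZMod q).val [MOD orderOf μ] → i = j) :
    (∃ y ≠ 0, (A (.ofAdd c) * D s) y = y) ∧
      ∀ f : V →ₗ[K] K, (∀ y, f ((A (.ofAdd c) * D s) y) = f y) → f v = 0 → f = 0 := by
  set h := A (.ofAdd c) * D s with h_def
  have hwpow (i : ℕ) : D (w ^ i) v = l ^ i • v := by
    induction i with
    | zero => simp
    | succ i ih =>
      rw [pow_succ', map_mul, Module.End.mul_apply, ih, map_smul, hw, smul_smul, pow_succ]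
  have hDD (r r' : (ZMod q)ˣ) : D r (D r' v) = D r' (D r v) := by
    rw [← Module.End.mul_apply, ← Module.End.mul_apply, ← map_mul, ← map_mul, mul_comm]
  have hq := eigenvalue_pow_eq_one hv0 hv
  have hμmul (x y : ZMod q) : μ ^ (x * y).val = (μ ^ y.val) ^ x.val := by
    rw [ZMod.val_mul, ← pow_mul, mul_comm y.val]
    exact (pow_eq_pow_mod _ hq).symm
  have hpow (t : ℕ) : ∃ a : K, a ≠ 0 ∧ (h ^ t) v = a • D (s ^ t) v := by
    rw [h_def, translation_mul_unit_pow hAD, Module.End.mul_apply,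
      apply_unit_apply_eigenvector hAD hv]
    exact ⟨_, pow_ne_zero _ hμ, rfl⟩
  have hmr (r : (ZMod q)ˣ) : (h ^ m) (D r v) =
      (ζ ^ ((r⁻¹ : (ZMod q)ˣ) : ZMod q).val * l ^ b) • D r v := by
    rw [h_def, translation_mul_unit_pow hAD, Module.End.mul_apply, hsm, hDD, hwpow, map_smul,
      map_smul, apply_unit_apply_eigenvector hAD hv, hμmul, ← hζ, smul_smul, mul_comm]
  have hmv : (h ^ m) v = v := by
    have := hmr 1
    rw [map_one, Module.End.one_apply, inv_one, Units.val_one] at this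
    rw [this]
    rw [ZMod.val_one, pow_one, hζl, one_smul]
  -- The fixed vector is the sum of the h-orbit of `v`, which closes up after `m` steps. It is
  -- nonzero because the orbit consists of eigenvectors of A(1) with distinct eigenvalues.
  refine ⟨⟨∑ t ∈ Finset.range m, (h ^ t) v, ?_, ?_⟩, ?_⟩
  · have hD0 (r : (ZMod q)ˣ) : D r v ≠ 0 := fun h0 => hv0 (by
      have : D (r⁻¹) (D r v) = v := by
        rw [← Module.End.mul_apply, ← map_mul, inv_mul_cancel, map_one, Module.End.one_apply]
      rw [← this, h0, map_zero])
    have hli : LinearIndependent K fun t : Fin m => (h ^ (t : ℕ)) v := by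
      refine Module.End.eigenvectors_linearIndependent' (A (.ofAdd 1))
        (fun t : Fin m => μ ^ ((s⁻¹ ^ (t : ℕ) : (ZMod q)ˣ) : ZMod q).val) ?_ _ ?_
      · intro i j hij
        exact Fin.ext (hinj i i.2 j j.2 ((pow_eq_pow_iff_modEq₀ hμ).mp hij))
      · intro t
        obtain ⟨a, ha, hat⟩ := hpow t
        refine Module.End.hasEigenvector_iff.mpr ⟨Module.End.mem_eigenspace_iff.mpr ?_, ?_⟩
        · rw [hat, map_smul, apply_unit_apply_eigenvector hAD hv, mul_one, inv_pow, smul_comm]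
        · rw [hat]
          exact smul_ne_zero ha (hD0 _)
    intro h0
    rw [← Fin.sum_univ_eq_sum_range (fun t => (h ^ t) v)] at h0
    have h1 := Fintype.linearIndependent_iff.mp hli (fun _ => (1 : K))
      (by simp only [one_smul]; exact h0) ⟨0, hm⟩
    exact one_ne_zero h1
  · rw [map_sum]
    simp_rw [← Module.End.mul_apply, ← pow_succ']
    have h1 := Finset.sum_range_succ (fun t => (h ^ t) v) m
    rw [Finset.sum_range_succ', hmv, pow_zero, Module.End.one_apply] at h1
    exact add_right_cancel h1
  · intro f hf hfv
    have hfpow (t : ℕ) (y : V) : f ((h ^ t) y) = f y := by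
      induction t with
      | zero => simp
      | succ t ih => rw [pow_succ', Module.End.mul_apply, hf, ih]
    -- A nonzero value forces h^m to fix D(r)v, so r ≡ 1 mod ord ζ; then D(r)v is a multiple of some
    -- h^i v, where `f` takes the value f(v) = 0.
    have hfD (r : (ZMod q)ˣ) : f (D r v) = 0 := by
      by_contra hne
      have h1 := hfpow m (D r v)
      rw [hmr, map_smul, smul_eq_mul] at h1
      have h2 := mul_right_cancel₀ hne (h1.trans (one_mul _).symm)
      have hlb : l ^ b ≠ 0 := right_ne_zero_of_mul (hζl.trans_ne one_ne_zero)
      have h3 : ζ ^ ((r⁻¹ : (ZMod q)ˣ) : ZMod q).val = ζ ^ 1 := by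
        rw [pow_one]
        exact mul_right_cancel₀ hlb (h2.trans hζl.symm)
      have hr : ∃ i j : ℕ, r = s ^ i * w ^ j := by
        apply hgen
        have hval (x y : ZMod q) : ζ ^ (x * y).val = (ζ ^ y.val) ^ x.val := by
          have hζq : ζ ^ q = 1 := by rw [hζ, ← pow_mul, mul_comm, pow_mul, hq, one_pow]
          rw [ZMod.val_mul, ← pow_mul, mul_comm y.val]
          exact (pow_eq_pow_mod _ hζq).symm
        have h5 := hval (r : ZMod q) ((r⁻¹ : (ZMod q)ˣ) : ZMod q)
        rw [h3, pow_one, Units.mul_inv] at h5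
        rw [ZMod.val_one] at h5
        exact (pow_eq_pow_iff_modEq₀ (left_ne_zero_of_mul (hζl.trans_ne one_ne_zero))).mp h5.symm
      obtain ⟨i, j, rfl⟩ := hr
      obtain ⟨a, ha, hai⟩ := hpow i
      apply hne
      have h4 := hfpow i v
      rw [hai, map_smul, hfv, smul_eq_mul, mul_eq_zero] at h4
      rw [map_mul, Module.End.mul_apply, hwpow, map_smul, map_smul, h4.resolve_left ha, smul_zero]
    have htop := hirr (Submodule.span K (Set.range fun r => D r v)) ?_ ?_ ?_
    · apply LinearMap.ext_on_range (v := fun r => D r v) htop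
      intro r
      simpa using hfD r
    · intro h0
      apply hv0
      have : D 1 v ∈ Submodule.span K (Set.range fun r => D r v) := Submodule.subset_span ⟨1, rfl⟩
      rw [h0] at this
      simpa using this
    · intro x y hy
      induction hy using Submodule.span_induction with
      | mem y hy =>
        obtain ⟨r, rfl⟩ := hy
        have := apply_unit_apply_eigenvector hAD hv r x.toAdd
        rw [ofAdd_toAdd] at this
        simp only [this]
        exact Submodule.smul_mem _ _ (Submodule.subset_span ⟨r, rfl⟩)
      | zero => simp
      | add y z _ _ hy hz => rw [map_add]; exact Submodule.add_mem _ hy hz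
      | smul a y _ hy => rw [map_smul]; exact Submodule.smul_mem _ _ hy
    · intro r y hy
      induction hy using Submodule.span_induction with
      | mem y hy =>
        obtain ⟨r', rfl⟩ := hy
        refine Submodule.subset_span ⟨r * r', ?_⟩
        simp
      | zero => simp
      | add y z _ _ hy hz => rw [map_add]; exact Submodule.add_mem _ hy hz
      | smul a y _ hy => rw [map_smul]; exact Submodule.smul_mem _ _ hy

end Monomial

/-! ### Arithmetic of units modulo a prime power. -/

/-- Lifting the exponent applied to a^(p^r) - 1, divided by a - 1. The case a = 1 is separate, since
a - 1 then has infinite valuation and cannot be cancelled. -/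
theorem Nat.exists_geom_sum_eq_prime_pow_mul {p : ℕ} (hp : p.Prime) (hodd : Odd p) {a : ℕ}
    (ha : a ≡ 1 [MOD p]) (r : ℕ) :
    ∃ y : ℕ, ¬ p ∣ y ∧ ∑ i ∈ Finset.range (p ^ r), a ^ i = p ^ r * y := by
  have ha' : (p : ℤ) ∣ (a : ℤ) - 1 := by
    have := (Nat.modEq_iff_dvd.mp ha.symm)
    simpa using this
  have hpa : ¬ (p : ℤ) ∣ (a : ℤ) := by
    intro h
    have h1 := (dvd_sub_right h).mp ha'
    exact hp.one_lt.ne' (by exact_mod_cast Int.eq_one_of_dvd_one (by positivity) h1)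
  have hmult : emultiplicity p (∑ i ∈ Finset.range (p ^ r), a ^ i) = r := by
    rcases eq_or_ne a 1 with rfl | h1
    · simp only [one_pow, Finset.sum_const, Finset.card_range, smul_eq_mul, mul_one]
      exact emultiplicity_pow_self_of_prime hp.prime r
    · have h := Int.emultiplicity_pow_sub_pow hp hodd (x := a) (y := 1) ha' hpa (p ^ r)
      have hgeom := mul_geom_sum (a : ℤ) (p ^ r)
      rw [one_pow, ← hgeom, emultiplicity_mul (Nat.prime_iff_prime_int.mp hp),
        emultiplicity_pow_self_of_prime hp.prime] at h
      have hfin : FiniteMultiplicity (p : ℤ) ((a : ℤ) - 1) :=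
        Int.finiteMultiplicity_iff.mpr ⟨by simpa using hp.one_lt.ne', by
          intro h0
          exact h1 (by exact_mod_cast sub_eq_zero.mp h0)⟩
      have h2 := ENat.add_right_injective_of_ne_top
        (finiteMultiplicity_iff_emultiplicity_ne_top.mp hfin) h
      rw [← h2, ← Int.natCast_emultiplicity]
      push_cast
      rfl
  obtain ⟨⟨y, hy⟩, hndvd⟩ := emultiplicity_eq_coe.mp hmult
  refine ⟨y, fun ⟨z, hz⟩ => hndvd ⟨z, ?_⟩, hy⟩
  rw [hy, hz, pow_succ, mul_assoc]

theorem ZMod.unitsMap_eq_unitsMap_iff {d q : ℕ} [NeZero q] (hd : d ∣ q) {r r' : (ZMod q)ˣ} :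
    ZMod.unitsMap hd r = ZMod.unitsMap hd r' ↔
      (r : ZMod q).val ≡ (r' : ZMod q).val [MOD d] := by
  rw [Units.ext_iff, ZMod.unitsMap_def, Units.coe_map, Units.coe_map, ← ZMod.natCast_eq_natCast_iff]
  conv_lhs => rw [← ZMod.natCast_zmod_val (r : ZMod q), ← ZMod.natCast_zmod_val (r' : ZMod q)]
  simp

section Generator

variable {q : ℕ} [NeZero q] {g : (ZMod q)ˣ}

theorem ZMod.orderOf_unitsMap_of_generator (hg : ∀ r, r ∈ Subgroup.zpowers g) {d : ℕ} (hd : d ∣ q) :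
    orderOf (ZMod.unitsMap hd g) = d.totient := by
  have : NeZero d := ⟨fun h => NeZero.ne q (Nat.eq_zero_of_zero_dvd (h ▸ hd))⟩
  rw [← ZMod.card_units_eq_totient, ← Nat.card_eq_fintype_card]
  apply orderOf_eq_card_of_forall_mem_zpowers
  intro x
  obtain ⟨y, rfl⟩ := ZMod.unitsMap_surjective hd x
  obtain ⟨t, rfl⟩ := hg y
  exact ⟨t, by simp⟩

/-- The image of `g` modulo `d` has order φ(d), so g^φ(d) generates the kernel of reduction. -/
theorem ZMod.exists_eq_pow_of_val_modEq_one [Fact (1 < q)] (hg : ∀ r, r ∈ Subgroup.zpowers g)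
    {d : ℕ} (hd : d ∣ q) {r : (ZMod q)ˣ} (hr : (r : ZMod q).val ≡ 1 [MOD d]) :
    ∃ t : ℕ, r = (g ^ d.totient) ^ t := by
  obtain ⟨t, rfl⟩ := mem_powers_iff_mem_zpowers.mpr (hg r)
  have h1 : ZMod.unitsMap hd (g ^ t) = ZMod.unitsMap hd 1 := by
    rw [ZMod.unitsMap_eq_unitsMap_iff, Units.val_one, ZMod.val_one]
    exact hr
  rw [map_one, map_pow] at h1
  obtain ⟨j, rfl⟩ := ZMod.orderOf_unitsMap_of_generator hg hd ▸ orderOf_dvd_of_pow_eq_one h1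
  exact ⟨j, by simp only [pow_mul]⟩

theorem ZMod.val_pow_totient_modEq_one [Fact (1 < q)] {d : ℕ} (hd : d ∣ q) (r : (ZMod q)ˣ) :
    ((r ^ d.totient : (ZMod q)ˣ) : ZMod q).val ≡ 1 [MOD d] := by
  have h1 : ZMod.unitsMap hd (r ^ d.totient) = ZMod.unitsMap hd 1 := by
    rw [map_pow, ZMod.pow_totient, map_one]
  rwa [ZMod.unitsMap_eq_unitsMap_iff, Units.val_one, ZMod.val_one] at h1

end Generator

theorem exists_pow_mul_eq_one {K : Type*} [Field K] {x y : K} {m : ℕ} (hm : 0 < m)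
    (hx : orderOf x = m) (hy : y ^ m = 1) : ∃ i : ℕ, x ^ i * y = 1 := by
  have : NeZero m := ⟨hm.ne'⟩
  have hy0 : y ≠ 0 := by
    rintro rfl
    simp [hm.ne'] at hy
  obtain ⟨i, -, hi⟩ := (hx ▸ IsPrimitiveRoot.orderOf x).eq_pow_of_pow_eq_one
    (show y⁻¹ ^ m = 1 by rw [inv_pow, hy, inv_one])
  exact ⟨i, by rw [hi, inv_mul_cancel₀ hy0]⟩

/-! ### Choice of the group element. -/

section Existence

variable {K V : Type*} [Field K] [IsAlgClosed K] [AddCommGroup V] [Module K V]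
  [FiniteDimensional K V] [Nontrivial V]

/-- The unit may depend on μ: it stabilizes the character, so its operator preserves the
μ-eigenspace and has an eigenvector there. -/
theorem exists_common_eigenvector {q : ℕ} [NeZero q]
    {A : Multiplicative (ZMod q) →* Module.End K V} {D : (ZMod q)ˣ →* Module.End K V}
    (hAD : ∀ (s : (ZMod q)ˣ) (x : ZMod q), D s * A (.ofAdd x) = A (.ofAdd (s * x)) * D s)
    (w : K → (ZMod q)ˣ)
    (hw : ∀ μ : K, ((w μ)⁻¹ : (ZMod q)ˣ).1.val ≡ 1 [MOD orderOf μ]) :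
    ∃ (μ l : K) (v : V), v ≠ 0 ∧ A (.ofAdd 1) v = μ • v ∧ D (w μ) v = l • v := by
  obtain ⟨μ, hμ⟩ := Module.End.exists_eigenvalue (A (.ofAdd 1))
  have hmaps : ∀ y ∈ Module.End.eigenspace (A (.ofAdd 1)) μ,
      D (w μ) y ∈ Module.End.eigenspace (A (.ofAdd 1)) μ := by
    intro y hy
    rw [Module.End.mem_eigenspace_iff] at hy ⊢
    rw [apply_unit_apply_eigenvector hAD hy, mul_one, ← pow_mod_orderOf, hw μ, pow_mod_orderOf,
      pow_one]
  obtain ⟨u, hu⟩ := hμ.exists_hasEigenvector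
  have : Nontrivial (Module.End.eigenspace (A (.ofAdd 1)) μ) :=
    ⟨⟨u, hu.1⟩, 0, fun h => hu.2 (congrArg Subtype.val h)⟩
  obtain ⟨l, hl⟩ := Module.End.exists_eigenvalue ((D (w μ)).restrict hmaps)
  obtain ⟨⟨v, hvE⟩, hv⟩ := hl.exists_hasEigenvector
  refine ⟨μ, l, v, fun h => hv.2 (Subtype.ext h), Module.End.mem_eigenspace_iff.mp hvE,
    congrArg Subtype.val (Module.End.mem_eigenspace_iff.mp hv.1)⟩

/-- For every irreducible representation of the holomorph of a cyclic group of odd prime power order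
(presented by the actions `A` of translations and `D` of units), some group element has a nonzero
fixed vector and at most a line of fixed functionals. -/
theorem exists_fixed_and_functional_unique_of_prime_pow {p : ℕ} (hp : p.Prime) (hodd : Odd p)
    {n : ℕ} (hn : 1 ≤ n) {A : Multiplicative (ZMod (p ^ n)) →* Module.End K V}
    {D : (ZMod (p ^ n))ˣ →* Module.End K V}
    (hAD : ∀ (s : (ZMod (p ^ n))ˣ) (x : ZMod (p ^ n)),
      D s * A (.ofAdd x) = A (.ofAdd (s * x)) * D s)
    (hirr : ∀ U : Submodule K V, U ≠ ⊥ → (∀ x, ∀ y ∈ U, A x y ∈ U) → (∀ s, ∀ y ∈ U, D s y ∈ U) →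
      U = ⊤) :
    ∃ (c : ZMod (p ^ n)) (s : (ZMod (p ^ n))ˣ) (v : V),
      (∃ y ≠ 0, (A (.ofAdd c) * D s) y = y) ∧
      ∀ f : V →ₗ[K] K, (∀ y, f ((A (.ofAdd c) * D s) y) = f y) → f v = 0 → f = 0 := by
  have hp0 := hp.pos
  have hq1 : 1 < p ^ n := Nat.one_lt_pow (by omega) hp.one_lt
  have : Fact (1 < p ^ n) := ⟨hq1⟩
  have : NeZero (p ^ n) := ⟨by positivity⟩
  have hcyc := ZMod.isCyclic_units_of_prime_pow p hp (by rintro rfl; exact absurd hodd (by decide)) n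
  obtain ⟨g, hg⟩ := hcyc.exists_generator
  have hdvd {i : ℕ} (hi : i ≤ n) : p ^ i ∣ p ^ n := pow_dvd_pow p hi
  -- The value 1 is a dummy: an actual eigenvalue has order dividing p^n.
  obtain ⟨μ, l, v, hv0, hv, hl⟩ := exists_common_eigenvector hAD
    (fun μ => if orderOf μ ∣ p ^ n then g ^ (orderOf μ).totient else 1) (by
      intro μ
      split_ifs with h
      · rw [← inv_pow]
        exact ZMod.val_pow_totient_modEq_one h _
      · rw [inv_one, Units.val_one, ZMod.val_one])
  have hμq : μ ^ p ^ n = 1 := eigenvalue_pow_eq_one hv0 hv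
  have hμ0 : μ ≠ 0 := by
    rintro rfl
    simp [hp.ne_zero] at hμq
  rw [if_pos (orderOf_dvd_of_pow_eq_one hμq)] at hl
  obtain ⟨k, hkn, hk⟩ := (Nat.dvd_prime_pow hp).mp (orderOf_dvd_of_pow_eq_one hμq)
  rw [hk] at hl
  have hgen {i : ℕ} (hi : i ≤ n) (r : (ZMod (p ^ n))ˣ)
      (hr : (r : ZMod (p ^ n)).val ≡ 1 [MOD p ^ i]) : ∃ t : ℕ, r = (g ^ (p ^ i).totient) ^ t :=
    ZMod.exists_eq_pow_of_val_modEq_one hg (hdvd hi) hr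
  set w := g ^ (p ^ k).totient with hw
  have hchi (i : ℕ) : μ ^ ((i : ZMod (p ^ n))).val = μ ^ i := by
    rw [ZMod.val_natCast]
    exact (pow_eq_pow_mod _ hμq).symm
  rcases Nat.eq_zero_or_pos k with rfl | hk0
  -- Here μ = 1 and w = g generates all units, so V is the line through `v` and h = 1 suffices.
  · refine ⟨0, 1, v, exists_fixed_and_functional_unique hAD hirr hv0 hv hl hμ0 (m := 1) (b := 0)
      (ζ := 1) one_pos (by simp) (by simp) (by simp) ?_ (by intros; omega)⟩
    intro r _
    obtain ⟨t, ht⟩ := hgen hkn r (by simpa using Nat.modEq_one)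
    exact ⟨0, t, by rw [pow_zero, one_mul, hw, ← ht]⟩
  have hwpow : w ^ p ^ (n - k) = 1 := by
    have h1 : (p ^ k).totient * p ^ (n - k) = (p ^ n).totient := by
      rw [Nat.totient_prime_pow hp hk0, Nat.totient_prime_pow hp hn, mul_right_comm, ← pow_add]
      congr 2
      omega
    rw [hw, ← pow_mul, h1, ZMod.pow_totient]
  have hlpow (i : ℕ) : D (w ^ i) v = l ^ i • v := by
    induction i with
    | zero => simp
    | succ i ih =>
      rw [pow_succ', map_mul, Module.End.mul_apply, ih, map_smul, hl, smul_smul, pow_succ]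
  have hl1 : l ^ p ^ (n - k) = 1 := by
    have h1 := hlpow (p ^ (n - k))
    rw [hwpow, map_one, Module.End.one_apply] at h1
    have h2 : (l ^ p ^ (n - k) - 1) • v = 0 := by rw [sub_smul, ← h1, one_smul, sub_self]
    exact sub_eq_zero.mp ((smul_eq_zero.mp h2).resolve_right hv0)
  have horder_pow {x : K} {a b : ℕ} (hx : orderOf x = p ^ a) (hab : b ≤ a) :
      orderOf (x ^ p ^ (a - b)) = p ^ b := by
    rw [orderOf_pow_of_dvd (pow_ne_zero _ hp.ne_zero) (hx ▸ pow_dvd_pow p (Nat.sub_le a b)), hx,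
      Nat.pow_div (Nat.sub_le a b) hp.pos, Nat.sub_sub_self hab]
  have horder_eq {x y : K} (hxy : x * y = 1) : orderOf x = orderOf y := by
    refine orderOf_eq_orderOf_iff.mpr fun t => ?_
    have h1 : x ^ t * y ^ t = 1 := by rw [← mul_pow, hxy, one_pow]
    constructor <;> intro h <;> simpa [h] using h1
  obtain ⟨j, hjn, hj⟩ := (Nat.dvd_prime_pow hp).mp (orderOf_dvd_of_pow_eq_one hl1)
  rcases lt_or_ge k j with hkj | hjk
  -- Since l^(p^(j-k)) has order p^k, it is inverse to a power ζ of μ. With m = 1 the vector `v`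
  -- itself is fixed, and ord ζ = p^k leaves only powers of `w`.
  · obtain ⟨i, hi⟩ := exists_pow_mul_eq_one (x := μ) (y := l ^ p ^ (j - k))
      (m := p ^ k) (by positivity) hk (by rw [← horder_pow hj hkj.le, pow_orderOf_eq_one])
    refine ⟨i, w ^ p ^ (j - k), v, exists_fixed_and_functional_unique hAD hirr hv0 hv hl hμ0
      (m := 1) (b := p ^ (j - k)) (ζ := μ ^ i) one_pos (by simp)
      (by rw [Finset.sum_range_one, pow_zero, mul_one, hchi]) hi ?_
      (by intros; omega)⟩
    intro r hr
    rw [horder_eq hi, horder_pow hj hkj.le] at hr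
    obtain ⟨t, ht⟩ := hgen hkn r hr
    exact ⟨0, t, by rw [pow_zero, one_mul, ← ht]⟩
  -- For j ≤ k take s = g^φ(p^j) and m = φ(p^k)/φ(p^j), so that s^m = w. The first `m` powers of `s`
  -- stay distinct mod p^k, where `g` has order φ(p^k).
  have hs_inj {m : ℕ} (hm : (p ^ j).totient * m = (p ^ k).totient) : ∀ i < m, ∀ i' < m,
      (((g ^ (p ^ j).totient)⁻¹ ^ i : (ZMod (p ^ n))ˣ) : ZMod (p ^ n)).val ≡
      (((g ^ (p ^ j).totient)⁻¹ ^ i' : (ZMod (p ^ n))ˣ) : ZMod (p ^ n)).val [MOD orderOf μ] →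
      i = i' := by
    intro i hi i' hi' h
    rw [hk, ← ZMod.unitsMap_eq_unitsMap_iff (hdvd hkn), inv_pow, inv_pow, map_inv, map_inv,
      inv_inj, ← pow_mul, ← pow_mul, map_pow, map_pow] at h
    have hpos : 0 < (p ^ j).totient := Nat.totient_pos.mpr (by positivity)
    have hlt {a : ℕ} (ha : a < m) :
        (p ^ j).totient * a < orderOf (ZMod.unitsMap (hdvd hkn) g) := by
      rw [ZMod.orderOf_unitsMap_of_generator hg, ← hm]
      exact Nat.mul_lt_mul_of_pos_left ha hpos
    exact Nat.eq_of_mul_eq_mul_left hpos (pow_injOn_Iio_orderOf (hlt hi) (hlt hi') h)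
  -- The translation `c` is chosen to make ζ = l⁻¹, of order p^j; the units ≡ 1 mod p^j are the
  -- powers of `s`.
  obtain ⟨m, c, hm0, hm, hc⟩ : ∃ (m : ℕ) (c : ZMod (p ^ n)), 0 < m ∧
      (p ^ j).totient * m = (p ^ k).totient ∧
      μ ^ (c * ∑ i ∈ Finset.range m,
        ((g ^ (p ^ j).totient : (ZMod (p ^ n))ˣ) : ZMod (p ^ n)) ^ i).val * l = 1 := by
    rcases Nat.eq_zero_or_pos j with rfl | hj0
    -- For j = 0, s = g need not be 1 mod p, so the geometric sum is not controlled; but l = 1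
    -- allows c = 0.
    · have hl_one : l = 1 := orderOf_eq_one_iff.mp (by rw [hj, pow_zero])
      exact ⟨(p ^ k).totient, 0, Nat.totient_pos.mpr (by positivity), by simp, by simp [hl_one]⟩
    · set u := g ^ (p ^ j).totient with hu
      have hval := ZMod.val_pow_totient_modEq_one (hdvd (hjk.trans hkn)) g
      rw [← hu] at hval
      -- The geometric sum is p^(k-j)·y with y prime to p. Some power of μ^(p^(k-j)), which has
      -- order p^j, equals l⁻¹; `c` is that exponent divided by y.
      obtain ⟨y, hy, hsum⟩ := Nat.exists_geom_sum_eq_prime_pow_mul hp hodd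
        (hval.of_dvd (dvd_pow_self p hj0.ne')) (k - j)
      obtain ⟨i, hi⟩ := exists_pow_mul_eq_one (y := l) (by positivity) (horder_pow hk hjk)
        (by rw [← hj, pow_orderOf_eq_one])
      have hyu : IsUnit (y : ZMod (p ^ n)) :=
        (ZMod.isUnit_iff_coprime _ _).mpr (((hp.coprime_iff_not_dvd.mpr hy).pow_left n).symm)
      obtain ⟨z, hz⟩ := hyu
      refine ⟨p ^ (k - j), ↑z⁻¹ * (i : ZMod (p ^ n)), by positivity, ?_, ?_⟩
      · rw [Nat.totient_prime_pow hp hk0, Nat.totient_prime_pow hp hj0, mul_right_comm, ← pow_add]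
        congr 2
        omega
      · have h1 : ∑ t ∈ Finset.range (p ^ (k - j)), (u : ZMod (p ^ n)) ^ t =
            (p ^ (k - j) : ℕ) * z := by
          rw [hz, ← Nat.cast_mul, ← hsum, Nat.cast_sum]
          simp
        rw [h1, show (↑z⁻¹ * (i : ZMod (p ^ n))) * ((p ^ (k - j) : ℕ) * z) =
          ((p ^ (k - j) * i : ℕ) : ZMod (p ^ n)) by
            rw [mul_comm _ (z : ZMod (p ^ n)), mul_mul_mul_comm, Units.inv_mul, one_mul, Nat.cast_mul,
              mul_comm], hchi, pow_mul]
        exact hi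
  refine ⟨c, g ^ (p ^ j).totient, v, exists_fixed_and_functional_unique hAD hirr hv0 hv hl hμ0
    (m := m) (b := 1) hm0 (by rw [← pow_mul, hm, pow_one]) rfl (by rwa [pow_one]) ?_ (hs_inj hm)⟩
  intro r hr
  rw [horder_eq hc, hj] at hr
  obtain ⟨t, ht⟩ := hgen (hjk.trans hkn) r hr
  exact ⟨t, 0, by rw [pow_zero, mul_one, ← ht]⟩

end Existence

/-! ### Application to the holomorph. -/

/-- The automorphism of the cyclic group of order `q` given by multiplication by a unit of
`ZMod q`. -/
noncomputable def ZMod.unitsEquivMulAut (q : ℕ) :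
    (ZMod q)ˣ ≃* MulAut (Multiplicative (ZMod q)) :=
  ((MulAutMultiplicative (ZMod q)).trans (ZMod.AddAutEquivUnits q).toMultiplicative).symm

theorem ZMod.unitsEquivMulAut_apply {q : ℕ} (s : (ZMod q)ˣ) (x : ZMod q) :
    ZMod.unitsEquivMulAut q s (.ofAdd x) = .ofAdd (s * x) := rfl

namespace Representation

theorem finiteDimensional_of_isIrreducible {K G V : Type*} [Field K] [Group G] [Finite G]
    [AddCommGroup V] [Module K V] (σ : Representation K G V) (hσ : σ.IsIrreducible) :
    FiniteDimensional K V := by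
  by_cases hV : ∃ v : V, v ≠ 0
  · obtain ⟨v, hv⟩ := hV
    let U : Subrepresentation σ :=
      { toSubmodule := Submodule.span K (Set.range fun g => σ g v)
        apply_mem_toSubmodule := fun g y hy => by
          induction hy using Submodule.span_induction with
          | mem y hy =>
            obtain ⟨r, rfl⟩ := hy
            exact Submodule.subset_span ⟨g * r, by simp⟩
          | zero => simp
          | add y z _ _ hy hz => rw [map_add]; exact Submodule.add_mem _ hy hz
          | smul a y _ hy => rw [map_smul]; exact Submodule.smul_mem _ _ hy }
    have hU : U = ⊤ := (hσ.eq_bot_or_eq_top U).resolve_left fun h => hv (by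
      have h1 : v ∈ U.toSubmodule := Submodule.subset_span ⟨1, by simp⟩
      rw [h] at h1
      exact (Submodule.mem_bot K).mp h1)
    have htop : Submodule.span K (Set.range fun g => σ g v) = ⊤ :=
      congrArg Subrepresentation.toSubmodule hU
    exact ⟨htop ▸ Submodule.fg_span (Set.finite_range _)⟩
  · push Not at hV
    have : Subsingleton V := ⟨fun a b => (hV a).trans (hV b).symm⟩
    infer_instance

theorem nontrivial_of_isIrreducible {K G V : Type*} [Field K] [Group G]
    [AddCommGroup V] [Module K V] (σ : Representation K G V) (hσ : σ.IsIrreducible) :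
    Nontrivial V := by
  by_contra h
  rw [not_nontrivial_iff_subsingleton] at h
  obtain ⟨U, U', hU⟩ := hσ.exists_pair_ne
  exact hU (Subrepresentation.toSubmodule_injective (Subsingleton.elim _ _))

end Representation

theorem lemma7p0p1 (p : ℕ) (hp : p.Prime) (hodd : Odd p) (n : ℕ) (hn : 1 ≤ n)
    {V : Type*} [AddCommGroup V] [Module ℂ V]
    (σ : Representation ℂ (Holomorph (Multiplicative (ZMod (p ^ n)))) V)
    (hσ : σ.IsIrreducible) :
    Representation.IsSchurIndex ℚ σ 1 := by
  have : NeZero (p ^ n) := ⟨pow_ne_zero _ hp.ne_zero⟩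
  have : Finite (MulAut (Multiplicative (ZMod (p ^ n)))) :=
    Finite.of_equiv _ (ZMod.unitsEquivMulAut (p ^ n)).toEquiv
  have : Finite (Holomorph (Multiplicative (ZMod (p ^ n)))) :=
    Finite.of_equiv _ SemidirectProduct.equivProd.symm
  have := σ.finiteDimensional_of_isIrreducible hσ
  have := σ.nontrivial_of_isIrreducible hσ
  let A : Multiplicative (ZMod (p ^ n)) →* Module.End ℂ V := σ.comp SemidirectProduct.inl
  let D : (ZMod (p ^ n))ˣ →* Module.End ℂ V :=
    (σ.comp SemidirectProduct.inr).comp (ZMod.unitsEquivMulAut (p ^ n)).toMonoidHom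
  have hAD (s : (ZMod (p ^ n))ˣ) (x : ZMod (p ^ n)) :
      D s * A (.ofAdd x) = A (.ofAdd (s * x)) * D s := by
    change σ _ * σ _ = σ _ * σ _
    rw [← map_mul, ← map_mul, ← ZMod.unitsEquivMulAut_apply]
    congr 1
    ext <;> simp
  obtain ⟨c, s, v, ⟨y, hy0, hy⟩, huniq⟩ :=
    exists_fixed_and_functional_unique_of_prime_pow hp hodd hn hAD (by
      intro U hU hUA hUD
      let U' : Subrepresentation σ :=
        { toSubmodule := U
          apply_mem_toSubmodule := fun g y hy => by
            rw [← SemidirectProduct.inl_left_mul_inr_right g, map_mul, Module.End.mul_apply]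
            refine hUA g.left _ ?_
            have := hUD ((ZMod.unitsEquivMulAut (p ^ n)).symm g.right) y hy
            simpa [D] using this }
      rcases hσ.eq_bot_or_eq_top U' with h | h
      · exact absurd (congrArg Subrepresentation.toSubmodule h) hU
      · exact congrArg Subrepresentation.toSubmodule h)
  let h : Holomorph (Multiplicative (ZMod (p ^ n))) :=
    SemidirectProduct.inl (.ofAdd c) * SemidirectProduct.inr (ZMod.unitsEquivMulAut (p ^ n) s)
  have hh : σ h = A (.ofAdd c) * D s := map_mul σ _ _
  rw [← hh] at hy huniq
  -- In finite dimension a fixed vector yields a fixed functional: σ(h) - 1 is not injective, hence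
  -- not surjective, and some nonzero functional kills its range.
  have hlt : LinearMap.range (σ h - 1) < ⊤ := by
    rw [lt_top_iff_ne_top, Ne, LinearMap.range_eq_top, ← LinearMap.injective_iff_surjective]
    intro hinj
    exact hy0 (hinj (by simp [hy]))
  obtain ⟨l, hl0, hl⟩ := Submodule.exists_le_ker_of_lt_top _ hlt
  refine Representation.isSchurIndex_one_of_invariant_functional hσ h hl0 (fun y => ?_) v huniq
  have := hl ⟨y, rfl⟩
  simpa [sub_eq_zero] using this
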